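/- Let $H$ be a finite-dimensional Hopf algebra over a field $\mathbf k$, with coproduct $\Delta(h)=\sum h_{(1)}\otimes h_{(2)}$, counit $\varepsilon$ and antipode $S$, and let $r\in (H\otimes H)^*$ be a universal $r$-form on $H$, i.e. $r$ is convolution invertible and for all $a,b,c\in H$ $$r(ab\otimes c)=\sum r(a\otimes c_{(1)})\,r(b\otimes c_{(2)}),\qquad r(a\otimes bc)=\sum r(a_{(1)}\otimes c)\,r(a_{(2)}\otimes b),\qquad \sum r(a_{(1)}\otimes b_{(1)})\,a_{(2)}b_{(2)}=\sum b_{(1)}a_{(1)}\,r(a_{(2)}\otimes b_{(2)}).$$ Let $A$ be a finite-dimensional right $H^{op}$-comodule algebra, that is, a finite-dimensional unital associative algebra with a right $H$-comodule structure $a\mapsto\sum a_{(0)}\otimes a_{(1)}$ such that $ab\mapsto\sum a_{(0)}b_{(0)}\otimes b_{(1)}a_{(1)}$ and $1\mapsto 1\otimes 1$. Let $\overline A$ be the comodule $A$ with the product $a\circ b=\sum b_{(0)}a_{(0)}\,r(b_{(1)}\otimes a_{(1)})$. For two such algebras $A,B$ let $A\#B$ be the space $A\otimes B$ with the coaction $a\otimes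 b\mapsto\sum a_{(0)}\otimes b_{(0)}\otimes b_{(1)}a_{(1)}$ and the product $(a\#b)(c\#d)=\sum (ac_{(0)}\#b_{(0)}d)\,r(c_{(1)}\otimes b_{(1)})$. Let $End(A)$ be the algebra of linear endomorphisms of $A$ under composition, with coaction $\rho(f)(a)=\sum f(a_{(0)})_{(0)}\otimes S^{-1}(a_{(1)})f(a_{(0)})_{(1)}$, and let $End(A)^{op}$ be the opposite algebra, with coaction $\rho(f)(a)=\sum f(a_{(0)})_{(0)}\otimes f(a_{(0)})_{(1)}S(a_{(1)})$. The algebra $A$ is called $(H,r)$-Azumaya if the maps $$F\colon A\#\overline A\to End(A),\qquad F(a\#b)(c)=\sum a\,c_{(0)}b_{(0)}\,r(c_{(1)}\otimes b_{(1)}),$$ $$G\colon \overline A\#A\to End(A)^{op},\qquad G(a\#b)(c)=\sum r(a_{(1)}\otimes c_{(1)})\,a_{(0)}c_{(0)}b,$$ are isomorphisms of $H^{op}$-comodule algebras. Then the algebra $H^{op}$ (the opposite algebra of $H$), with coaction $\Delta$, is $(H,r)$-Azumaya if and only if the map $\theta_r\colon H^{op}\to H^*$, $h\mapsto r(-\otimes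 h)$, is bijective. -/

import Mathlib

open scoped TensorProduct

noncomputable section

namespace DualQuasitriangular

universe u v w w'

/-! ### Universal r-forms -/

section RForm

variable {k : Type u} {H : Type v} [Field k] [Ring H] [HopfAlgebra k H]

/-- `r : H ⊗ H → k` is a universal r-form on the Hopf algebra `H`, that is, `(H, r)` is a dual
quasitriangular Hopf algebra. -/
structure IsUniversalRForm (r : H ⊗[k] H →ₗ[k] k) : Prop where
  /-- `r` is invertible in the convolution algebra `(H ⊗ H)^*`. -/
  convInvertible : IsUnit (WithConv.toConv r)
  /-- `r(ab ⊗ c) = ∑ r(a ⊗ c₁) r(b ⊗ c₂)`. -/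
  mul_left : ∀ a b c : H,
    r ((a * b) ⊗ₜ[k] c) =
      LinearMap.mul' k k (TensorProduct.map (TensorProduct.curry r a) (TensorProduct.curry r b)
        (Coalgebra.comul c))
  /-- `r(a ⊗ bc) = ∑ r(a₁ ⊗ c) r(a₂ ⊗ b)`. -/
  mul_right : ∀ a b c : H,
    r (a ⊗ₜ[k] (b * c)) =
      LinearMap.mul' k k (TensorProduct.map ((TensorProduct.curry r).flip c)
        ((TensorProduct.curry r).flip b) (Coalgebra.comul a))
  /-- `∑ r(a₁ ⊗ b₁) a₂b₂ = ∑ b₁a₁ r(a₂ ⊗ b₂)`; the coproduct of `a ⊗ b` in the coalgebra `H ⊗ H`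
  is `∑ (a₁ ⊗ b₁) ⊗ (a₂ ⊗ b₂)`. -/
  mul_comm : ∀ a b : H,
    TensorProduct.lid k H (TensorProduct.map r (LinearMap.mul' k H)
        (Coalgebra.comul (R := k) (a ⊗ₜ[k] b))) =
      TensorProduct.rid k H
        (TensorProduct.map (LinearMap.mul' k H ∘ₗ (TensorProduct.comm k H H).toLinearMap) r
          (Coalgebra.comul (R := k) (a ⊗ₜ[k] b)))

/-- The map `θ_r : H^op → H^*`, `h ↦ r(- ⊗ h)`. -/
def theta (r : H ⊗[k] H →ₗ[k] k) : Hᵐᵒᵖ →ₗ[k] Module.Dual k H :=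
  (TensorProduct.curry r).flip ∘ₗ (MulOpposite.opLinearEquiv k).symm.toLinearMap

variable (k H) in
/-- The inverse `S⁻¹` of the antipode of a finite-dimensional Hopf algebra (the antipode of such a
Hopf algebra is bijective, so `Ring.inverse` is the honest inverse for composition). -/
def antipodeInv : H →ₗ[k] H :=
  Ring.inverse (HopfAlgebra.antipode k : Module.End k H)

end RForm

/-! ### Algebras in the category of right `H`-comodules -/

/-- A vector space with a product, a unit and a right coaction of `H`, with no laws imposed. -/
structure AlgData (k : Type u) (H : Type v) (A : Type w) [Field k] [Ring H] [HopfAlgebra k H]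
    [AddCommGroup A] [Module k A] where
  /-- the product -/
  mul : A ⊗[k] A →ₗ[k] A
  /-- the unit element -/
  one : A
  /-- the coaction `a ↦ ∑ a₀ ⊗ a₁` -/
  coact : A →ₗ[k] A ⊗[k] H

section Maps

variable {k : Type u} {H : Type v} {M : Type w} {N : Type w'} [Field k] [Ring H] [HopfAlgebra k H]
  [AddCommGroup M] [Module k M] [AddCommGroup N] [Module k N]

/-- The coaction `m ⊗ n ↦ ∑ m₀ ⊗ n₀ ⊗ n₁m₁` on the tensor product of two comodules. -/
def tensorCoact (ρM : M →ₗ[k] M ⊗[k] H) (ρN : N →ₗ[k] N ⊗[k] H) :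
    M ⊗[k] N →ₗ[k] (M ⊗[k] N) ⊗[k] H :=
  (LinearMap.mul' k H ∘ₗ (TensorProduct.comm k H H).toLinearMap).lTensor (M ⊗[k] N) ∘ₗ
    (TensorProduct.tensorTensorTensorComm k M H N H).toLinearMap ∘ₗ
    TensorProduct.map ρM ρN

/-- The braiding `ψ(m ⊗ n) = ∑ n₀ ⊗ m₀ r(n₁ ⊗ m₁)`. -/
def braiding (r : H ⊗[k] H →ₗ[k] k) (ρM : M →ₗ[k] M ⊗[k] H) (ρN : N →ₗ[k] N ⊗[k] H) :
    M ⊗[k] N →ₗ[k] N ⊗[k] M :=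
  (TensorProduct.rid k (N ⊗[k] M)).toLinearMap ∘ₗ
    r.lTensor (N ⊗[k] M) ∘ₗ
    (TensorProduct.tensorTensorTensorComm k N H M H).toLinearMap ∘ₗ
    TensorProduct.map ρN ρM ∘ₗ
    (TensorProduct.comm k M N).toLinearMap

/-- For `s : H ⊗ H → H`, the coaction `ρ` on `End(M)` determined by
`ρ(f)(m) = ∑ f(m₀)₀ ⊗ s(f(m₀)₁ ⊗ m₁)`; the finite-dimensionality of `M` is used to identify
`End(M) ⊗ H` with `Hom(M, M ⊗ H)`. -/
def endCoact [FiniteDimensional k M] (s : H ⊗[k] H →ₗ[k] H) (ρ : M →ₗ[k] M ⊗[k] H) :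
    Module.End k M →ₗ[k] Module.End k M ⊗[k] H :=
  (rTensorHomEquivHomRTensor k M M H).symm.toLinearMap ∘ₗ
    { toFun := fun f =>
        s.lTensor M ∘ₗ (TensorProduct.assoc k M H H).toLinearMap ∘ₗ ρ.rTensor H ∘ₗ
          f.rTensor H ∘ₗ ρ
      map_add' := fun f g => by
        simp only [LinearMap.rTensor_add, LinearMap.add_comp, LinearMap.comp_add]
      map_smul' := fun c f => by
        simp only [LinearMap.rTensor_smul, LinearMap.smul_comp, LinearMap.comp_smul,
          RingHom.id_apply] }

end Maps

/-- An algebra in the category of finite-dimensional right `H`-comodules, i.e. a finite-dimensional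
right `H^op`-comodule algebra: `A` is an associative unital algebra and a right `H`-comodule, and
its product and unit are comodule maps, so that the coaction satisfies
`ab ↦ ∑ a₀b₀ ⊗ b₁a₁` and `1 ↦ 1 ⊗ 1`. -/
structure OpComoduleAlgebra (k : Type u) (H : Type v) (A : Type w) [Field k] [Ring H]
    [HopfAlgebra k H] [AddCommGroup A] [Module k A] extends AlgData k H A where
  finite : FiniteDimensional k A
  mul_assoc : ∀ a b c : A,
    mul (mul (a ⊗ₜ[k] b) ⊗ₜ[k] c) = mul (a ⊗ₜ[k] mul (b ⊗ₜ[k] c))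
  one_mul : ∀ a : A, mul (one ⊗ₜ[k] a) = a
  mul_one : ∀ a : A, mul (a ⊗ₜ[k] one) = a
  coassoc : (TensorProduct.assoc k A H H).toLinearMap ∘ₗ coact.rTensor H ∘ₗ coact =
    (Coalgebra.comul (R := k) (A := H)).lTensor A ∘ₗ coact
  coact_counit : (TensorProduct.rid k A).toLinearMap ∘ₗ
    (Coalgebra.counit (R := k) (A := H)).lTensor A ∘ₗ coact = LinearMap.id
  coact_mul : coact ∘ₗ mul = mul.rTensor H ∘ₗ tensorCoact coact coact
  coact_one : coact one = one ⊗ₜ[k] (1 : H)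

namespace AlgData

variable {k : Type u} {H : Type v} {A : Type w} {B : Type w'} [Field k] [Ring H] [HopfAlgebra k H]
  [AddCommGroup A] [Module k A] [AddCommGroup B] [Module k B]

/-- `f` is an isomorphism of comodule algebras from `X` to `Y`. -/
structure IsIso (X : AlgData k H A) (Y : AlgData k H B) (f : A →ₗ[k] B) : Prop where
  bijective : Function.Bijective f
  map_mul : f ∘ₗ X.mul = Y.mul ∘ₗ TensorProduct.map f f
  map_one : f X.one = Y.one
  map_coact : Y.coact ∘ₗ f = f.rTensor H ∘ₗ X.coact

/-- The opposite algebra in the category: the same comodule, with product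
`a ∘ b = ∑ b₀a₀ r(b₁ ⊗ a₁)`. -/
def opposite (r : H ⊗[k] H →ₗ[k] k) (X : AlgData k H A) : AlgData k H A where
  mul := X.mul ∘ₗ braiding r X.coact X.coact
  one := X.one
  coact := X.coact

/-- The algebra `A # B`: the comodule `A ⊗ B` with product
`(a # b)(c # d) = ∑ (ac₀ # b₀d) r(c₁ ⊗ b₁)`. -/
def smash (r : H ⊗[k] H →ₗ[k] k) (X : AlgData k H A) (Y : AlgData k H B) :
    AlgData k H (A ⊗[k] B) where
  mul := TensorProduct.map X.mul Y.mul ∘ₗ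
    (TensorProduct.assoc k A A (B ⊗[k] B)).symm.toLinearMap ∘ₗ
    ((TensorProduct.assoc k A B B).toLinearMap ∘ₗ
      (braiding r Y.coact X.coact).rTensor B ∘ₗ
      (TensorProduct.assoc k B A B).symm.toLinearMap).lTensor A ∘ₗ
    (TensorProduct.assoc k A B (A ⊗[k] B)).toLinearMap
  one := X.one ⊗ₜ[k] Y.one
  coact := tensorCoact X.coact Y.coact

/-- `End(A)` with composition of endomorphisms and coaction
`ρ(f)(a) = ∑ f(a₀)₀ ⊗ S⁻¹(a₁) f(a₀)₁`. -/
def endAlg [FiniteDimensional k A] (X : AlgData k H A) : AlgData k H (Module.End k A) where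
  mul := LinearMap.mul' k (Module.End k A)
  one := 1
  coact := endCoact
    (LinearMap.mul' k H ∘ₗ (TensorProduct.comm k H H).toLinearMap ∘ₗ (antipodeInv k H).lTensor H)
    X.coact

/-- `End(A)^op`, the product of `f` and `g` being `g ∘ f`, with coaction
`ρ(f)(a) = ∑ f(a₀)₀ ⊗ f(a₀)₁ S(a₁)`. -/
def endOpAlg [FiniteDimensional k A] (X : AlgData k H A) : AlgData k H (Module.End k A) where
  mul := LinearMap.mul' k (Module.End k A) ∘ₗ
    (TensorProduct.comm k (Module.End k A) (Module.End k A)).toLinearMap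
  one := 1
  coact := endCoact (LinearMap.mul' k H ∘ₗ (HopfAlgebra.antipode k (A := H)).lTensor H) X.coact

/-- `F(a # b)(c) = ∑ a c₀ b₀ r(c₁ ⊗ b₁)`. -/
def mapF (r : H ⊗[k] H →ₗ[k] k) (X : AlgData k H A) : A ⊗[k] A →ₗ[k] Module.End k A :=
  TensorProduct.curry
    (X.mul ∘ₗ (X.mul ∘ₗ braiding r X.coact X.coact).lTensor A ∘ₗ
      (TensorProduct.assoc k A A A).toLinearMap)

/-- `G(a # b)(c) = ∑ r(a₁ ⊗ c₁) a₀ c₀ b`. -/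
def mapG (r : H ⊗[k] H →ₗ[k] k) (X : AlgData k H A) : A ⊗[k] A →ₗ[k] Module.End k A :=
  TensorProduct.curry
    (X.mul ∘ₗ (X.mul ∘ₗ braiding r X.coact X.coact).rTensor A ∘ₗ
      (TensorProduct.assoc k A A A).symm.toLinearMap ∘ₗ
      (TensorProduct.comm k (A ⊗[k] A) A).toLinearMap)

end AlgData

/-- An algebra `A` in the category of finite-dimensional right `H`-comodules is
`(H, r)`-Azumaya if `F : A # Ā → End(A)` and `G : Ā # A → End(A)^op` are isomorphisms of
`H^op`-comodule algebras. -/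
def OpComoduleAlgebra.IsAzumaya {k : Type u} {H : Type v} {A : Type w} [Field k] [Ring H]
    [HopfAlgebra k H] [AddCommGroup A] [Module k A] (r : H ⊗[k] H →ₗ[k] k)
    (X : OpComoduleAlgebra k H A) : Prop :=
  haveI := X.finite
  AlgData.IsIso (X.toAlgData.smash r (X.toAlgData.opposite r)) X.toAlgData.endAlg
      (X.toAlgData.mapF r) ∧
    AlgData.IsIso ((X.toAlgData.opposite r).smash r X.toAlgData) X.toAlgData.endOpAlg
      (X.toAlgData.mapG r)

/-- The algebra `H^op`, with the coproduct of `H` as coaction, as an algebra in the category of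
right `H`-comodules. -/
def opAlgebra (k : Type u) (H : Type v) [Field k] [Ring H] [HopfAlgebra k H]
    [FiniteDimensional k H] : OpComoduleAlgebra k H Hᵐᵒᵖ where
  mul := LinearMap.mul' k Hᵐᵒᵖ
  one := 1
  coact := (MulOpposite.opLinearEquiv k).toLinearMap.rTensor H ∘ₗ
    Coalgebra.comul (R := k) (A := H) ∘ₗ (MulOpposite.opLinearEquiv k).symm.toLinearMap
  finite := Module.Finite.equiv (MulOpposite.opLinearEquiv k : H ≃ₗ[k] Hᵐᵒᵖ)
  mul_assoc a b c := by simp [_root_.mul_assoc]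
  one_mul a := by simp
  mul_one a := by simp
  coassoc := by
    have h1 (w : H ⊗[k] H) (y : H) : TensorProduct.assoc k Hᵐᵒᵖ H H
        ((MulOpposite.opLinearEquiv k).toLinearMap.rTensor H w ⊗ₜ[k] y) =
        (MulOpposite.opLinearEquiv k).toLinearMap.rTensor (H ⊗[k] H)
          (TensorProduct.assoc k H H H (w ⊗ₜ[k] y)) := by
      induction w with
      | zero => simp
      | add u v hu hv => simp only [map_add, TensorProduct.add_tmul, hu, hv]
      | tmul u v => simp
    have h2 (z : H ⊗[k] H) : TensorProduct.assoc k Hᵐᵒᵖ H H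
        (((MulOpposite.opLinearEquiv k).toLinearMap.rTensor H ∘ₗ
          Coalgebra.comul (R := k) (A := H) ∘ₗ
          (MulOpposite.opLinearEquiv k).symm.toLinearMap).rTensor H
            ((MulOpposite.opLinearEquiv k).toLinearMap.rTensor H z)) =
        (MulOpposite.opLinearEquiv k).toLinearMap.rTensor (H ⊗[k] H)
          (TensorProduct.assoc k H H H ((Coalgebra.comul (R := k) (A := H)).rTensor H z)) := by
      induction z with
      | zero => simp
      | add u v hu hv => simp only [map_add, hu, hv]
      | tmul u v => simpa using h1 (Coalgebra.comul u) v
    have h3 (z : H ⊗[k] H) : (Coalgebra.comul (R := k) (A := H)).lTensor Hᵐᵒᵖ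
          ((MulOpposite.opLinearEquiv k).toLinearMap.rTensor H z) =
        (MulOpposite.opLinearEquiv k).toLinearMap.rTensor (H ⊗[k] H)
          ((Coalgebra.comul (R := k) (A := H)).lTensor H z) := by
      induction z with
      | zero => simp
      | add u v hu hv => simp only [map_add, hu, hv]
      | tmul u v => simp
    refine LinearMap.ext fun x => ?_
    simp only [LinearMap.comp_apply, LinearEquiv.coe_coe] at h2 ⊢
    rw [h2, h3, Coalgebra.coassoc_apply]
  coact_counit := by
    have h (z : H ⊗[k] H) : TensorProduct.rid k Hᵐᵒᵖ
          ((Coalgebra.counit (R := k) (A := H)).lTensor Hᵐᵒᵖ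
            ((MulOpposite.opLinearEquiv k).toLinearMap.rTensor H z)) =
        MulOpposite.op (TensorProduct.rid k H
          ((Coalgebra.counit (R := k) (A := H)).lTensor H z)) := by
      induction z with
      | zero => simp
      | add u v hu hv => simp only [map_add, hu, hv, MulOpposite.op_add]
      | tmul u v => simp
    refine LinearMap.ext fun x => ?_
    simp only [LinearMap.comp_apply, LinearEquiv.coe_coe]
    rw [h, Coalgebra.lTensor_counit_comul]
    simp
  coact_mul := by
    have h (z w : H ⊗[k] H) : (MulOpposite.opLinearEquiv k).toLinearMap.rTensor H (w * z) =
        (LinearMap.mul' k Hᵐᵒᵖ).rTensor H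
          ((LinearMap.mul' k H ∘ₗ (TensorProduct.comm k H H).toLinearMap).lTensor (Hᵐᵒᵖ ⊗[k] Hᵐᵒᵖ)
            (TensorProduct.tensorTensorTensorComm k Hᵐᵒᵖ H Hᵐᵒᵖ H
              ((MulOpposite.opLinearEquiv k).toLinearMap.rTensor H z ⊗ₜ[k]
                (MulOpposite.opLinearEquiv k).toLinearMap.rTensor H w))) := by
      induction z with
      | zero => simp
      | add u v hu hv => simp only [mul_add, map_add, TensorProduct.add_tmul, hu, hv]
      | tmul u v =>
        induction w with
        | zero => simp
        | add u v hu hv => simp only [add_mul, map_add, TensorProduct.tmul_add, hu, hv]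
        | tmul p q => simp
    refine TensorProduct.ext' fun a b => ?_
    simp only [tensorCoact, LinearMap.comp_apply, LinearEquiv.coe_coe, LinearMap.mul'_apply,
      TensorProduct.map_tmul, MulOpposite.coe_opLinearEquiv_symm, MulOpposite.unop_mul,
      Bialgebra.comul_mul] at h ⊢
    exact h _ _
  coact_one := by
    simp [Algebra.TensorProduct.one_def]

end DualQuasitriangular

end

open scoped TensorProduct

noncomputable section

namespace DualQuasitriangular

-- For every universal r-form the maps F and G attached to `H^op` are morphisms of comodule
-- algebras, so the Azumaya condition is only their bijectivity, and by equality of dimensions only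
-- their injectivity. Put b∘c = ∑ b₁c₁ r(c₂⊗b₂) = ∑ r(c₁⊗b₁) c₂b₂ (`braidedMul`). With products
-- taken in H, F(a#b)(c) = (b∘c)a and G(a#b)(c) = b(c∘a). Multiplicativity follows from
-- associativity of ∘ and from the rules for b∘(ec) and (bx)∘c; compatibility with the coactions
-- follows from Δ(b∘c) = ∑ b₁∘c₁ ⊗ c₂b₂ (`sw_braidedMul`).
--
-- Convolving with S⁻¹ strips the factor c from F: ∑ S⁻¹(c₂) F(a#b)(c₁) = ∑ r(c⊗b₁) b₂a. As a⊗b ↦ ∑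
-- b₁⊗b₂a is invertible, injectivity of θ_r gives that of F (`mapF_injective`). Similarly ∑
-- G(a#b)(c₁) S(c₂) = ∑ r(a₁⊗c) ba₂, so G is injective when a ↦ r(a⊗-), the transpose of θ_r, is
-- (`mapG_injective`). Conversely, if θ_r(b) = 0 then F kills ∑ S(b₂)⊗b₁, and applying ε to the
-- first factor recovers b (`theta_injective_of_mapF`).
--
-- The inverse of S comes from r itself: the functional u(h) = ∑ r(h₁⊗S h₂) implements S² by
-- convolution conjugation, so S⁻¹ = u * S * u⁻¹.

attribute [fun_prop] IsLinearMap

/-! ### Linearity of functions as a goal for `fun_prop` -/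

section Linear

variable {k M N P : Type*} [Field k] [AddCommGroup M] [Module k M] [AddCommGroup N] [Module k N]
  [AddCommGroup P] [Module k P]

@[fun_prop]
theorem isLinearMap_id : IsLinearMap k (fun x : M => x) := ⟨fun _ _ => rfl, fun _ _ => rfl⟩

@[fun_prop]
theorem isLinearMap_comp {f : N → P} {g : M → N} (hf : IsLinearMap k f) (hg : IsLinearMap k g) :
    IsLinearMap k (fun x => f (g x)) :=
  ⟨fun x y => by rw [hg.map_add, hf.map_add], fun c x => by rw [hg.map_smul, hf.map_smul]⟩

@[fun_prop]
theorem isLinearMap_coe (f : M →ₗ[k] N) : IsLinearMap k f := f.isLinear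

@[fun_prop]
theorem isLinearMap_coe_apply {f : M → N →ₗ[k] P} (hf : IsLinearMap k f) (y : N) :
    IsLinearMap k (fun x => f x y) :=
  ⟨fun x y => by simp [hf.map_add], fun c x => by simp [hf.map_smul]⟩

@[fun_prop]
theorem isLinearMap_mul_const {A : Type*} [Ring A] [Algebra k A] {f : M → A}
    (hf : IsLinearMap k f) (c : A) : IsLinearMap k (fun x => f x * c) :=
  ⟨fun x y => by rw [hf.map_add, add_mul], fun c x => by rw [hf.map_smul, smul_mul_assoc]⟩

@[fun_prop]
theorem isLinearMap_const_mul {A : Type*} [Ring A] [Algebra k A] {f : M → A}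
    (hf : IsLinearMap k f) (c : A) : IsLinearMap k (fun x => c * f x) :=
  ⟨fun x y => by rw [hf.map_add, mul_add], fun c x => by rw [hf.map_smul, mul_smul_comm]⟩

@[fun_prop]
theorem isLinearMap_smul_const {f : M → k} (hf : IsLinearMap k f) (c : N) :
    IsLinearMap k (fun x => f x • c) :=
  ⟨fun x y => by rw [hf.map_add, add_smul], fun c x => by rw [hf.map_smul, smul_assoc]⟩

@[fun_prop]
theorem isLinearMap_const_smul {f : M → N} (hf : IsLinearMap k f) (c : k) :
    IsLinearMap k (fun x => c • f x) :=
  ⟨fun x y => by rw [hf.map_add, smul_add], fun c x => by rw [hf.map_smul, smul_comm]⟩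

@[fun_prop]
theorem isLinearMap_tmul_const {f : M → N} (hf : IsLinearMap k f) (c : P) :
    IsLinearMap k (fun x => f x ⊗ₜ[k] c) :=
  ⟨fun x y => by rw [hf.map_add, TensorProduct.add_tmul],
    fun c x => by rw [hf.map_smul, TensorProduct.smul_tmul']⟩

@[fun_prop]
theorem isLinearMap_const_tmul {f : M → P} (hf : IsLinearMap k f) (c : N) :
    IsLinearMap k (fun x => c ⊗ₜ[k] f x) :=
  ⟨fun x y => by rw [hf.map_add, TensorProduct.tmul_add],
    fun c x => by rw [hf.map_smul, TensorProduct.tmul_smul]⟩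

@[fun_prop]
theorem isLinearMap_op {f : M → N} (hf : IsLinearMap k f) :
    IsLinearMap k (fun x => MulOpposite.op (f x)) :=
  ⟨fun x y => by rw [hf.map_add, MulOpposite.op_add],
    fun c x => by rw [hf.map_smul, MulOpposite.op_smul]⟩

@[fun_prop]
theorem isLinearMap_sum {ι : Type*} {s : Finset ι} {f : ι → M → N}
    (hf : ∀ i, IsLinearMap k (f i)) : IsLinearMap k (fun x => ∑ i ∈ s, f i x) :=
  ⟨fun x y => by simp only [(hf _).map_add, Finset.sum_add_distrib],
    fun c x => by simp only [(hf _).map_smul, Finset.smul_sum]⟩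

end Linear

/-! ### Sweedler calculus in a Hopf algebra -/

section Sweedler

variable {k H M N : Type*} [Field k] [Ring H] [HopfAlgebra k H] [AddCommGroup M] [Module k M]
  [AddCommGroup N] [Module k N]

open Coalgebra

variable (k) in
/-- The Sweedler sum `∑ f(h₁, h₂)`. -/
def sw (h : H) (f : H → H → M) : M :=
  ∑ i ∈ (ℛ k h).index, f ((ℛ k h).left i) ((ℛ k h).right i)

/-- For bilinear `f` the sum depends only on `comul h`, not on the representation chosen by `ℛ`.
This is what makes `sw` linear in `h` and lets it be computed on units and products. -/
theorem sw_eq_lift {f : H → H → M} (hf₁ : ∀ y, IsLinearMap k (fun x => f x y))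
    (hf₂ : ∀ x, IsLinearMap k (f x)) (h : H) :
    sw k h f = TensorProduct.lift
      (LinearMap.mk₂ k f (fun x x' y => (hf₁ y).map_add x x') (fun c x y => (hf₁ y).map_smul c x)
        (fun x y y' => (hf₂ x).map_add y y') (fun c x y => (hf₂ x).map_smul c y)) (comul h) := by
  rw [← (ℛ k h).eq]
  simp [sw]

@[fun_prop]
theorem isLinearMap_sw {g : N → H} {f : H → H → M} (hg : IsLinearMap k g)
    (hf₁ : ∀ y, IsLinearMap k (fun x => f x y))
    (hf₂ : ∀ x, IsLinearMap k (fun y => f x y)) : IsLinearMap k (fun x => sw k (g x) f) := by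
  simp only [sw_eq_lift hf₁ hf₂]
  fun_prop

@[fun_prop]
theorem isLinearMap_sw_right (h : H) {f : N → H → H → M}
    (hf : ∀ x y, IsLinearMap k (fun t => f t x y)) : IsLinearMap k (fun t => sw k h (f t)) := by
  simp only [sw]
  fun_prop

omit [Module k M] in
theorem sw_congr {h : H} {f g : H → H → M} (hfg : ∀ x y, f x y = g x y) : sw k h f = sw k h g := by
  rw [show f = g from funext₂ hfg]

theorem sw_comul (h : H) : sw k h (fun x y => x ⊗ₜ[k] y) = comul h := (ℛ k h).eq

theorem map_sw {φ : M → N} (hφ : IsLinearMap k φ) (h : H) (f : H → H → M) :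
    φ (sw k h f) = sw k h fun x y => φ (f x y) := by
  simp only [sw]
  exact map_sum (hφ.mk') _ _

omit [Module k M] in
theorem sw_comm (a b : H) (f : H → H → H → H → M) :
    (sw k a fun x y => sw k b fun z w => f x y z w) =
      sw k b fun z w => sw k a fun x y => f x y z w :=
  Finset.sum_comm

/-- Coassociativity, oriented so that rewriting brings nested sums to the right-nested form. -/
theorem sw_assoc {f : H → H → H → M} (hf₁ : ∀ y z, IsLinearMap k (fun x => f x y z))
    (hf₂ : ∀ x z, IsLinearMap k (fun y => f x y z)) (hf₃ : ∀ x y, IsLinearMap k (f x y)) (h : H) :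
    (sw k h fun t z => sw k t fun x y => f x y z) = sw k h fun x t => sw k t fun y z => f x y z := by
  have key := Coalgebra.sum_tmul_tmul_eq (ℛ k h) (fun _ => ℛ k _) (fun _ => ℛ k _)
  let g : H →ₗ[k] H →ₗ[k] H →ₗ[k] M := LinearMap.mk₂ k (fun x y => (hf₃ x y).mk')
    (fun x x' y => LinearMap.ext fun z => (hf₁ y z).map_add x x')
    (fun c x y => LinearMap.ext fun z => (hf₁ y z).map_smul c x)
    (fun x y y' => LinearMap.ext fun z => (hf₂ x z).map_add y y')
    (fun c x y => LinearMap.ext fun z => (hf₂ x z).map_smul c y)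
  have := congr(TensorProduct.lift
    ((TensorProduct.lift.equiv (.id k) H H M).toLinearMap ∘ₗ g) $key)
  simpa [sw, g] using this

theorem coe_sw {F : Type*} [FunLike F M N] [LinearMapClass F k M N] (φ : F) (h : H)
    (f : H → H → M) : φ (sw k h f) = sw k h fun x y => φ (f x y) :=
  map_sw ⟨map_add φ, map_smul φ⟩ h f

theorem coe_sw_apply (h : H) (f : H → H → M →ₗ[k] N) (m : M) :
    sw k h f m = sw k h fun x y => f x y m :=
  map_sw (isLinearMap_coe_apply isLinearMap_id m) h f

theorem sw_mul_const {A : Type*} [Ring A] [Algebra k A] (h : H) (f : H → H → A) (c : A) :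
    sw k h f * c = sw k h fun x y => f x y * c :=
  map_sw (isLinearMap_mul_const isLinearMap_id c) h f

theorem const_mul_sw {A : Type*} [Ring A] [Algebra k A] (h : H) (f : H → H → A) (c : A) :
    c * sw k h f = sw k h fun x y => c * f x y :=
  map_sw (isLinearMap_const_mul isLinearMap_id c) h f

theorem sw_smul_const (h : H) (f : H → H → k) (c : M) :
    sw k h f • c = sw k h fun x y => f x y • c :=
  map_sw (isLinearMap_smul_const isLinearMap_id c) h f

theorem const_smul_sw (h : H) (f : H → H → M) (c : k) :
    c • sw k h f = sw k h fun x y => c • f x y :=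
  map_sw (isLinearMap_const_smul isLinearMap_id c) h f

theorem sw_tmul_const (h : H) (f : H → H → M) (c : N) :
    sw k h f ⊗ₜ[k] c = sw k h fun x y => f x y ⊗ₜ[k] c :=
  map_sw (isLinearMap_tmul_const isLinearMap_id c) h f

theorem const_tmul_sw (h : H) (f : H → H → M) (c : N) :
    c ⊗ₜ[k] sw k h f = sw k h fun x y => c ⊗ₜ[k] f x y :=
  map_sw (isLinearMap_const_tmul isLinearMap_id c) h f

theorem op_sw (h : H) (f : H → H → M) :
    MulOpposite.op (sw k h f) = sw k h fun x y => MulOpposite.op (f x y) :=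
  map_sw (isLinearMap_op isLinearMap_id) h f

theorem sw_counit_smul {g : H → M} (hg : IsLinearMap k g) (h : H) :
    (sw k h fun x y => counit (R := k) x • g y) = g h := by
  simp only [← hg.map_smul]
  rw [← map_sw hg, sw, sum_counit_smul]

theorem sw_smul_counit {g : H → M} (hg : IsLinearMap k g) (h : H) :
    (sw k h fun x y => counit (R := k) y • g x) = g h := by
  have := congr(TensorProduct.rid k H $(sum_tmul_counit_eq (ℛ k h)))
  simp only [map_sum, TensorProduct.rid_tmul, one_smul] at this
  simp only [← hg.map_smul]
  rw [← map_sw hg, sw, this]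

theorem sw_antipode_mul (h : H) :
    (sw k h fun x y => HopfAlgebra.antipode k x * y) = counit (R := k) h • (1 : H) :=
  HopfAlgebra.sum_antipode_mul_eq_smul _

theorem sw_mul_antipode (h : H) :
    (sw k h fun x y => x * HopfAlgebra.antipode k y) = counit (R := k) h • (1 : H) :=
  HopfAlgebra.sum_mul_antipode_eq_smul _

theorem sw_one {f : H → H → M} (hf₁ : ∀ y, IsLinearMap k (fun x => f x y))
    (hf₂ : ∀ x, IsLinearMap k (fun y => f x y)) : sw k (1 : H) f = f 1 1 := by
  rw [sw_eq_lift hf₁ hf₂]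
  simp [Algebra.TensorProduct.one_def]

theorem sw_mul {f : H → H → M} (hf₁ : ∀ y, IsLinearMap k (fun x => f x y))
    (hf₂ : ∀ x, IsLinearMap k (fun y => f x y)) (a b : H) :
    sw k (a * b) f = sw k a fun x y => sw k b fun z w => f (x * z) (y * w) := by
  rw [sw_eq_lift hf₁ hf₂, Bialgebra.comul_mul, ← sw_comul, ← sw_comul]
  simp only [sw, Finset.sum_mul_sum, map_sum]
  simp

theorem sw_antipode_mul_cancel {g : H → H → M} (hg₁ : ∀ y, IsLinearMap k (fun x => g x y))
    (hg₂ : ∀ x, IsLinearMap k (fun y => g x y)) (h : H) :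
    (sw k h fun x t => sw k t fun y z => g (HopfAlgebra.antipode k x * y) z) = g 1 h := by
  rw [← sw_assoc (by fun_prop) (by fun_prop) (by fun_prop), ← sw_counit_smul (hg₂ 1)]
  refine sw_congr fun t z => ?_
  rw [← (hg₁ z).map_smul, ← sw_antipode_mul, map_sw (hg₁ z)]

theorem sw_mul_antipode_cancel {g : H → H → M} (hg₁ : ∀ y, IsLinearMap k (fun x => g x y))
    (hg₂ : ∀ x, IsLinearMap k (fun y => g x y)) (h : H) :
    (sw k h fun x t => sw k t fun y z => g (x * HopfAlgebra.antipode k y) z) = g 1 h := by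
  rw [← sw_assoc (by fun_prop) (by fun_prop) (by fun_prop), ← sw_counit_smul (hg₂ 1)]
  refine sw_congr fun t z => ?_
  rw [← (hg₁ z).map_smul, ← sw_mul_antipode, map_sw (hg₁ z)]

theorem sw_mul_antipode_cancel_right {g : H → H → M}
    (hg₁ : ∀ y, IsLinearMap k (fun x => g x y)) (hg₂ : ∀ x, IsLinearMap k (fun y => g x y))
    (h : H) :
    (sw k h fun t z => sw k t fun x y => g x (y * HopfAlgebra.antipode k z)) = g h 1 := by
  rw [sw_assoc (by fun_prop) (by fun_prop) (by fun_prop), ← sw_smul_counit (hg₁ 1)]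
  refine sw_congr fun x t => ?_
  rw [← (hg₂ x).map_smul, ← sw_mul_antipode, map_sw (hg₂ x)]

/-- Both sides are convolution inverses of `comul` among the maps H → H ⊗ H: the right side is a
left inverse by two antipode cancellations, and Δ ∘ S is a right inverse. -/
theorem comul_antipode (h : H) :
    comul (R := k) (HopfAlgebra.antipode k h) =
      sw k h fun x y => HopfAlgebra.antipode k y ⊗ₜ[k] HopfAlgebra.antipode k x := by
  let S := HopfAlgebra.antipode k (A := H)
  let G : H →ₗ[k] H ⊗[k] H := IsLinearMap.mk' (fun h => sw k h fun x y => S y ⊗ₜ[k] S x)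
    (by fun_prop)
  have hG : WithConv.toConv G * WithConv.toConv (comul (R := k) (A := H)) = 1 := by
    ext h
    rw [(ℛ k h).convMul_apply]
    change (sw k h fun x y => (sw k x fun x y => S y ⊗ₜ[k] S x) * comul (R := k) y) = _
    simp only [← sw_comul, sw_mul_const]
    simp only [const_mul_sw, Algebra.TensorProduct.tmul_mul_tmul]
    simp (disch := fun_prop) only [sw_assoc]
    have h₁ (x t : H) : (sw k t fun y t => sw k t fun z w => (S y * z) ⊗ₜ[k] (S x * w)) =
        1 ⊗ₜ[k] (S x * t) :=
      sw_antipode_mul_cancel (g := fun z w => z ⊗ₜ[k] (S x * w)) (by fun_prop) (by fun_prop) t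
    simp only [h₁, ← const_tmul_sw, S, sw_antipode_mul]
    simp [Algebra.TensorProduct.one_def, Algebra.algebraMap_eq_smul_one]
  have := left_inv_eq_right_inv hG LinearMap.comul_right_inv
  exact congr($(this.symm).ofConv h)

theorem sw_antipode {f : H → H → M} (hf₁ : ∀ y, IsLinearMap k (fun x => f x y))
    (hf₂ : ∀ x, IsLinearMap k (fun y => f x y)) (h : H) :
    sw k (HopfAlgebra.antipode k h) f =
      sw k h fun x y => f (HopfAlgebra.antipode k y) (HopfAlgebra.antipode k x) := by
  rw [sw_eq_lift hf₁ hf₂, comul_antipode, coe_sw]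
  simp

end Sweedler

/-! ### Universal r-forms, the Drinfeld functional and the inverse of the antipode -/

section RFormSweedler

open Coalgebra HopfAlgebra

variable {k H M : Type*} [Field k] [Ring H] [HopfAlgebra k H] [AddCommGroup M] [Module k M]
  {r : H ⊗[k] H →ₗ[k] k}

namespace IsUniversalRForm

variable (hr : IsUniversalRForm r)

include hr

theorem mul_tmul (a b c : H) :
    r ((a * b) ⊗ₜ[k] c) = sw k c fun x y => r (a ⊗ₜ[k] x) * r (b ⊗ₜ[k] y) := by
  rw [hr.mul_left, ← sw_comul]
  simp [coe_sw]

theorem tmul_mul (a b c : H) :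
    r (a ⊗ₜ[k] (b * c)) = sw k a fun x y => r (x ⊗ₜ[k] c) * r (y ⊗ₜ[k] b) := by
  rw [hr.mul_right, ← sw_comul]
  simp [coe_sw]

theorem sw_mul_comm (a b : H) {φ : H → M} (hφ : IsLinearMap k φ) :
    (sw k a fun x y => sw k b fun z w => r (x ⊗ₜ[k] z) • φ (y * w)) =
      sw k a fun x y => sw k b fun z w => r (y ⊗ₜ[k] w) • φ (z * x) := by
  have := congr(φ $(hr.mul_comm a b))
  simp only [TensorProduct.comul_tmul] at this
  simp only [← sw_comul, sw_tmul_const] at this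
  simpa [const_tmul_sw, coe_sw, map_sw hφ, hφ.map_smul] using this

theorem exists_convInverse : ∃ q : H ⊗[k] H →ₗ[k] k, ∀ a b : H,
    (sw k a fun x y => sw k b fun z w => r (x ⊗ₜ[k] z) * q (y ⊗ₜ[k] w)) =
      counit (R := k) a * counit (R := k) b := by
  obtain ⟨q, hq⟩ := hr.convInvertible.exists_right_inv
  refine ⟨q.ofConv, fun a b => ?_⟩
  have := congr($(hq).ofConv (a ⊗ₜ[k] b))
  simp only [LinearMap.convMul_def, LinearMap.comp_apply, TensorProduct.comul_tmul] at this
  simp only [← sw_comul, sw_tmul_const] at this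
  rw [_root_.mul_comm (counit (R := k) a)]
  simpa [const_tmul_sw, coe_sw, LinearMap.convOne_def] using this

/-- The functional r(- ⊗ 1) is idempotent for convolution, because 1 · 1 = 1, and has the
convolution inverse q(- ⊗ 1); an invertible idempotent is the unit. -/
theorem tmul_one (a : H) : r (a ⊗ₜ[k] 1) = counit (R := k) a := by
  obtain ⟨q, hq⟩ := hr.exists_convInverse
  have h₁ (a : H) : (sw k a fun x y => r (x ⊗ₜ[k] 1) * q (y ⊗ₜ[k] 1)) = counit (R := k) a := by
    have := hq a 1
    simp (disch := fun_prop) only [sw_one] at this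
    simpa using this
  have h₂ (a : H) : (sw k a fun x y => r (x ⊗ₜ[k] 1) * r (y ⊗ₜ[k] 1)) = r (a ⊗ₜ[k] 1) := by
    simpa using (hr.tmul_mul a 1 1).symm
  rw [← h₁, ← sw_congr fun x y => congr($(h₂ x) * _)]
  simp only [sw_mul_const]
  simp (disch := fun_prop) only [sw_assoc, mul_assoc]
  simp only [← const_mul_sw, h₁]
  simpa [_root_.mul_comm] using
    (sw_smul_counit (k := k) (g := fun x => r (x ⊗ₜ[k] 1)) (by fun_prop) a).symm

theorem one_tmul (a : H) : r (1 ⊗ₜ[k] a) = counit (R := k) a := by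
  obtain ⟨q, hq⟩ := hr.exists_convInverse
  have h₁ (a : H) : (sw k a fun x y => r (1 ⊗ₜ[k] x) * q (1 ⊗ₜ[k] y)) = counit (R := k) a := by
    have := hq 1 a
    simp (disch := fun_prop) only [sw_one] at this
    simpa using this
  have h₂ (a : H) : (sw k a fun x y => r (1 ⊗ₜ[k] x) * r (1 ⊗ₜ[k] y)) = r (1 ⊗ₜ[k] a) := by
    simpa using (hr.mul_tmul 1 1 a).symm
  rw [← h₁, ← sw_congr fun x y => congr($(h₂ x) * _)]
  simp only [sw_mul_const]
  simp (disch := fun_prop) only [sw_assoc, mul_assoc]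
  simp only [← const_mul_sw, h₁]
  simpa [_root_.mul_comm] using
    (sw_smul_counit (k := k) (g := fun x => r (1 ⊗ₜ[k] x)) (by fun_prop) a).symm

omit hr in
variable (r) in
/-- The functional `h ↦ ∑ r(h₁ ⊗ S h₂)`. -/
def drinfeld : H →ₗ[k] k :=
  IsLinearMap.mk' (fun h => sw k h fun x y => r (x ⊗ₜ[k] antipode k y)) (by fun_prop)

omit hr in
variable (r) in
/-- The functional `h ↦ ∑ r(S² h₁ ⊗ h₂)`, a convolution inverse of `drinfeld r`. -/
def drinfeldInv : H →ₗ[k] k :=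
  IsLinearMap.mk' (fun h => sw k h fun x y => r (antipode k (antipode k x) ⊗ₜ[k] y)) (by fun_prop)

omit hr in
theorem drinfeld_apply (h : H) : drinfeld r h = sw k h fun x y => r (x ⊗ₜ[k] antipode k y) := rfl

omit hr in
theorem drinfeldInv_apply (h : H) :
    drinfeldInv r h = sw k h fun x y => r (antipode k (antipode k x) ⊗ₜ[k] y) := rfl

/-- The commutation law for h₁ ⊗ S(h₂) reads ∑ r(h₁⊗S h₄) h₂S(h₃) = ∑ r(h₂⊗S h₃) S(h₄)h₁, and on the
left h₂S(h₃) cancels. -/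
theorem sw_drinfeld_smul_antipode_mul (h : H) :
    (sw k h fun x t => sw k t fun y z => drinfeld r y • (antipode k z * x)) =
      drinfeld r h • (1 : H) := by
  have h₁ (a b : H) := hr.sw_mul_comm a (antipode k b) (isLinearMap_id (k := k) (M := H))
  simp (disch := fun_prop) only [sw_antipode] at h₁
  have h₂ : (sw k h fun a b => sw k a fun x y => sw k b fun z w =>
      r (x ⊗ₜ[k] antipode k w) • (y * antipode k z)) = _ := sw_congr fun a b => h₁ a b
  simp (disch := fun_prop) only [sw_assoc] at h₂
  simp only [drinfeld_apply, sw_smul_const]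
  simp (disch := fun_prop) only [sw_assoc]
  rw [← h₂]
  refine sw_congr fun x t => ?_
  exact (sw_mul_antipode_cancel (k := k) (g := fun y w => r (x ⊗ₜ[k] antipode k w) • y)
    (by fun_prop) (by fun_prop) t)

/-- This is S² as conjugation by u. Multiplying the previous identity on the left by S² of a further
leg produces S²(h₄)S(h₃) = S(h₃S(h₄)), which cancels. -/
theorem sw_drinfeld_smul (h : H) :
    (sw k h fun x y => drinfeld r y • x) =
      sw k h fun x y => drinfeld r x • antipode k (antipode k y) := by
  have h₁ : (sw k h fun x y => drinfeld r x • antipode k (antipode k y)) =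
      sw k h fun x y => antipode k (antipode k y) * (drinfeld r x • 1) := by simp
  rw [h₁]
  simp only [← hr.sw_drinfeld_smul_antipode_mul, const_mul_sw]
  simp (disch := fun_prop) only [sw_assoc]
  refine sw_congr fun x t => ?_
  simp only [mul_smul_comm, ← mul_assoc, ← antipode_mul_antidistrib]
  rw [← sw_smul_counit (k := k) (g := fun y => drinfeld r y • x) (by fun_prop) t]
  refine sw_congr fun y t => ?_
  rw [← const_smul_sw, ← sw_mul_const, ← coe_sw, sw_mul_antipode, smul_comm]
  simp

/-- Moving u past S² turns the sum into ∑ r(h₂⊗S h₃) r(h₁⊗h₄) = ∑ r(h₁⊗S(h₂)h₃), which collapses to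
r(h⊗1). -/
theorem sw_drinfeld_mul_drinfeldInv (h : H) :
    (sw k h fun x y => drinfeld r x * drinfeldInv r y) = counit (R := k) h := by
  simp only [drinfeldInv_apply, const_mul_sw]
  rw [← sw_assoc (by fun_prop) (by fun_prop) (by fun_prop)]
  have h₁ (t z : H) := congr(r ($(hr.sw_drinfeld_smul t) ⊗ₜ[k] z))
  simp only [sw_tmul_const, coe_sw, TensorProduct.smul_tmul, TensorProduct.tmul_smul, map_smul,
    smul_eq_mul] at h₁
  simp only [← h₁]
  have h₂ : (sw k h fun w t => sw k t fun y z => r (w ⊗ₜ[k] (antipode k y * z))) =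
      counit (R := k) h := by
    simp only [← coe_sw, ← const_tmul_sw, sw_antipode_mul]
    simp only [TensorProduct.tmul_smul, coe_sw, map_smul, hr.tmul_one]
    exact sw_smul_counit (k := k) (g := counit (R := k) (A := H)) (by fun_prop) h
  rw [← h₂]
  simp only [drinfeld_apply, sw_mul_const, hr.tmul_mul]
  rw [sw_congr (k := k) (M := k) fun w t => sw_comm t w _]
  simp (disch := fun_prop) only [sw_assoc, _root_.mul_comm]

/-- `h ↦ ∑ drinfeld(h₁) S(h₂) drinfeldInv(h₃)`, the inverse of the antipode. -/
def skewAntipode (r : H ⊗[k] H →ₗ[k] k) : H →ₗ[k] H :=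
  IsLinearMap.mk' (fun h => sw k h fun x t => sw k t fun y z =>
    (drinfeld r x * drinfeldInv r z) • antipode k y) (by fun_prop)

omit hr in
theorem skewAntipode_apply (h : H) : skewAntipode r h = sw k h fun x t => sw k t fun y z =>
    (drinfeld r x * drinfeldInv r z) • antipode k y := rfl

theorem sw_skewAntipode_mul (h : H) :
    (sw k h fun x y => skewAntipode r y * x) = counit (R := k) h • (1 : H) := by
  simp only [skewAntipode_apply, sw_mul_const]
  have h₁ : (sw k h fun w c => drinfeldInv r c • sw k w fun x t => sw k t fun a b =>
      drinfeld r a • (antipode k b * x)) = counit (R := k) h • (1 : H) := by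
    simp only [hr.sw_drinfeld_smul_antipode_mul, smul_smul, ← sw_smul_const,
      _root_.mul_comm (drinfeldInv r _), hr.sw_drinfeld_mul_drinfeldInv]
  rw [← h₁]
  simp only [const_smul_sw]
  simp (disch := fun_prop) only [sw_assoc]
  simp only [smul_mul_assoc, smul_smul, _root_.mul_comm (drinfeldInv r _)]

theorem sw_skewAntipode_mul_cancel {g : H → H → M} (hg₁ : ∀ y, IsLinearMap k (fun x => g x y))
    (hg₂ : ∀ x, IsLinearMap k (fun y => g x y)) (h : H) :
    (sw k h fun t z => sw k t fun x y => g x (skewAntipode r z * y)) = g h 1 := by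
  rw [sw_assoc (by fun_prop) (by fun_prop) (by fun_prop), ← sw_smul_counit (hg₁ 1)]
  refine sw_congr fun x t => ?_
  rw [← (hg₂ x).map_smul, ← hr.sw_skewAntipode_mul, map_sw (hg₂ x)]

theorem antipode_skewAntipode (h : H) : antipode k (skewAntipode r h) = h := by
  -- Insert h₁S(h₂) in front of S(S⁻¹(h₃)); by antimultiplicativity the last two factors become
  -- S(S⁻¹(h₃)h₂), which cancels.
  have h₁ := sw_mul_antipode_cancel (k := k) (g := fun x z => x * antipode k (skewAntipode r z))
    (by fun_prop) (by fun_prop) h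
  rw [one_mul] at h₁
  rw [← h₁]
  simp only [mul_assoc, ← antipode_mul_antidistrib, ← const_mul_sw, ← coe_sw,
    hr.sw_skewAntipode_mul]
  simpa using sw_smul_counit (k := k) (isLinearMap_id (M := H)) h

theorem skewAntipode_antipode [FiniteDimensional k H] (h : H) :
    skewAntipode r (antipode k h) = h := by
  have h₁ : (antipode k : Module.End k H) * skewAntipode r = 1 :=
    LinearMap.ext hr.antipode_skewAntipode
  exact congr($(mul_eq_one_comm.1 h₁) h)

theorem antipodeInv_eq [FiniteDimensional k H] : antipodeInv k H = skewAntipode r :=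
  Ring.inverse_unit (⟨antipode k, skewAntipode r, LinearMap.ext hr.antipode_skewAntipode,
    LinearMap.ext hr.skewAntipode_antipode⟩ : (Module.End k H)ˣ)

/-- Apply the antimultiplicative map S⁻¹ to ∑ h₁S(h₂) = ε(h)1. -/
theorem sw_mul_skewAntipode [FiniteDimensional k H] (h : H) :
    (sw k h fun x y => y * skewAntipode r x) = counit (R := k) h • (1 : H) := by
  have h₁ := congr(skewAntipode r $(sw_mul_antipode (k := k) h))
  have h₂ : skewAntipode r (1 : H) = 1 := by
    simpa using hr.skewAntipode_antipode (1 : H)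
  rw [coe_sw, map_smul, h₂] at h₁
  rw [← h₁]
  refine sw_congr fun x y => ?_
  rw [← hr.skewAntipode_antipode (y * _), antipode_mul_antidistrib, hr.antipode_skewAntipode]

theorem sw_mul_skewAntipode_cancel [FiniteDimensional k H] {g : H → H → M}
    (hg₁ : ∀ y, IsLinearMap k (fun x => g x y)) (hg₂ : ∀ x, IsLinearMap k (fun y => g x y))
    (h : H) : (sw k h fun x t => sw k t fun y z => g x (z * skewAntipode r y)) = g h 1 := by
  rw [← sw_smul_counit (hg₁ 1)]
  refine sw_congr fun x t => ?_
  rw [← (hg₂ x).map_smul, ← hr.sw_mul_skewAntipode, map_sw (hg₂ x)]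

end IsUniversalRForm

end RFormSweedler

/-! ### The braided opposite product on H -/

section BraidedMul

open Coalgebra HopfAlgebra

variable {k H M : Type*} [Field k] [Ring H] [HopfAlgebra k H] [AddCommGroup M] [Module k M]
  {r : H ⊗[k] H →ₗ[k] k}

/-- Coassociativity of H ⊗ H, splitting both tensor factors in parallel. -/
theorem sw_assoc₂ {f : H → H → H → H → H → H → M}
    (hf₁ : ∀ y₁ x₂ y₂ x₃ y₃, IsLinearMap k (fun x₁ => f x₁ y₁ x₂ y₂ x₃ y₃))
    (hg₁ : ∀ x₁ x₂ y₂ x₃ y₃, IsLinearMap k (fun y₁ => f x₁ y₁ x₂ y₂ x₃ y₃))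
    (hf₂ : ∀ x₁ y₁ y₂ x₃ y₃, IsLinearMap k (fun x₂ => f x₁ y₁ x₂ y₂ x₃ y₃))
    (hg₂ : ∀ x₁ y₁ x₂ x₃ y₃, IsLinearMap k (fun y₂ => f x₁ y₁ x₂ y₂ x₃ y₃))
    (hf₃ : ∀ x₁ y₁ x₂ y₂ y₃, IsLinearMap k (fun x₃ => f x₁ y₁ x₂ y₂ x₃ y₃))
    (hg₃ : ∀ x₁ y₁ x₂ y₂ x₃, IsLinearMap k (fun y₃ => f x₁ y₁ x₂ y₂ x₃ y₃)) (a b : H) :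
    (sw k a fun t x₃ => sw k b fun u y₃ => sw k t fun x₁ x₂ => sw k u fun y₁ y₂ =>
      f x₁ y₁ x₂ y₂ x₃ y₃) =
    sw k a fun x₁ t => sw k b fun y₁ u => sw k t fun x₂ x₃ => sw k u fun y₂ y₃ =>
      f x₁ y₁ x₂ y₂ x₃ y₃ := by
  calc
    _ = sw k a fun t x₃ => sw k t fun x₁ x₂ => sw k b fun u y₃ => sw k u fun y₁ y₂ =>
        f x₁ y₁ x₂ y₂ x₃ y₃ := sw_congr fun _ _ => sw_comm _ _ _
    _ = sw k a fun x₁ t => sw k t fun x₂ x₃ => sw k b fun y₁ u => sw k u fun y₂ y₃ =>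
        f x₁ y₁ x₂ y₂ x₃ y₃ := by simp (disch := fun_prop) only [sw_assoc]
    _ = _ := sw_congr fun _ _ => sw_comm _ _ _

/-- The product `∑ b₁c₁ r(c₂ ⊗ b₂)` on `H` of the braided opposite of `H^op`. -/
def braidedMul (r : H ⊗[k] H →ₗ[k] k) (b c : H) : H :=
  sw k b fun x y => sw k c fun z w => r (w ⊗ₜ[k] y) • (x * z)

@[fun_prop]
theorem isLinearMap_braidedMul_left {f : M → H} (hf : IsLinearMap k f) (c : H) :
    IsLinearMap k (fun x => braidedMul r (f x) c) := by
  unfold braidedMul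
  fun_prop

@[fun_prop]
theorem isLinearMap_braidedMul_right {f : M → H} (hf : IsLinearMap k f) (b : H) :
    IsLinearMap k (fun x => braidedMul r b (f x)) := by
  unfold braidedMul
  fun_prop

namespace IsUniversalRForm

variable (hr : IsUniversalRForm r)

include hr

theorem braidedMul_eq (b c : H) :
    braidedMul r b c = sw k b fun x y => sw k c fun z w => r (z ⊗ₜ[k] x) • (w * y) := by
  rw [braidedMul, sw_comm, sw_comm b c]
  exact (hr.sw_mul_comm c b isLinearMap_id).symm

theorem one_braidedMul (c : H) : braidedMul r 1 c = c := by
  unfold braidedMul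
  rw [sw_one (by fun_prop) (by fun_prop)]
  simpa [hr.tmul_one] using sw_smul_counit (k := k) (isLinearMap_id (M := H)) c

theorem braidedMul_one (b : H) : braidedMul r b 1 = b := by
  unfold braidedMul
  simp (disch := fun_prop) only [sw_one]
  simpa [hr.one_tmul] using sw_smul_counit (k := k) (isLinearMap_id (M := H)) b

/-- This rule is what matches F with the product of A # Ā; `mul_braidedMul` plays the same role for
G. -/
theorem braidedMul_mul (b e c : H) :
    braidedMul r b (e * c) =
      sw k b fun x y => sw k c fun z w => r (w ⊗ₜ[k] y) • (braidedMul r x e * z) := by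
  unfold braidedMul
  simp (disch := fun_prop) only [sw_mul]
  simp only [hr.mul_tmul, sw_mul_const, sw_smul_const, const_smul_sw]
  calc
    _ = sw k b fun x t => sw k t fun y₁ y₂ => sw k c fun z w => sw k e fun p q =>
        r (w ⊗ₜ[k] y₂) • (r (q ⊗ₜ[k] y₁) • (x * p)) * z := by
      refine sw_congr fun x t => ?_
      rw [sw_congr (k := k) fun p q => sw_comm c t _, sw_comm]
      refine sw_congr fun y₁ y₂ => ?_
      rw [sw_comm]
      simp only [mul_smul, smul_mul_assoc, mul_assoc, smul_comm (r (_ ⊗ₜ[k] y₁))]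
    _ = _ := by
      rw [← sw_assoc (by fun_prop) (by fun_prop) (by fun_prop)]
      refine sw_congr fun x y => ?_
      rw [sw_comm]
      simp only [smul_mul_assoc]

theorem mul_braidedMul (b x c : H) :
    braidedMul r (b * x) c =
      sw k b fun b₁ b₂ => sw k c fun c₁ c₂ => r (c₂ ⊗ₜ[k] b₂) • (b₁ * braidedMul r x c₁) := by
  unfold braidedMul
  simp (disch := fun_prop) only [sw_mul]
  simp only [hr.tmul_mul, const_mul_sw, sw_smul_const, const_smul_sw]
  refine sw_congr fun b₁ b₂ => ?_
  rw [sw_comm x c, sw_congr (k := k) fun p q => sw_comm x q _]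
  rw [sw_congr (k := k) (h := c) fun p q => sw_comm x p _]
  rw [← sw_assoc (by fun_prop) (by fun_prop) (by fun_prop)]
  simp only [mul_smul, mul_smul_comm, mul_assoc, smul_comm (r (_ ⊗ₜ[k] b₂))]

/-- The coproduct gives ∑ b₁c₁ ⊗ b₂c₂ r(c₃⊗b₃), and the commutation law replaces b₂c₂ r(c₃⊗b₃) by
r(c₂⊗b₂) c₃b₃. -/
theorem sw_braidedMul {f : H → H → M} (hf₁ : ∀ y, IsLinearMap k (fun x => f x y))
    (hf₂ : ∀ x, IsLinearMap k (fun y => f x y)) (b c : H) :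
    sw k (braidedMul r b c) f = sw k b fun x y => sw k c fun z w =>
      f (braidedMul r x z) (w * y) := by
  have h₁ : sw k (braidedMul r b c) f = sw k b fun x y => sw k c fun z w =>
      r (w ⊗ₜ[k] y) • sw k (x * z) f := by
    have hf : IsLinearMap k (fun h => sw k h f) := by fun_prop
    rw [braidedMul, map_sw hf]
    simp only [map_sw hf, hf.map_smul]
  have h₂ (x z w y : H) : f (braidedMul r x z) (w * y) = sw k x fun x₁ x₂ => sw k z fun z₁ z₂ =>
      r (z₂ ⊗ₜ[k] x₂) • f (x₁ * z₁) (w * y) := by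
    rw [braidedMul, map_sw (hf₁ _)]
    simp only [map_sw (hf₁ _), (hf₁ _).map_smul]
  rw [h₁]
  simp (disch := fun_prop) only [sw_mul, h₂]
  simp only [const_smul_sw]
  rw [sw_assoc₂ (by fun_prop) (by fun_prop) (by fun_prop) (by fun_prop) (by fun_prop)
    (by fun_prop), sw_assoc₂ (by fun_prop) (by fun_prop) (by fun_prop) (by fun_prop) (by fun_prop)
    (by fun_prop)]
  refine sw_congr fun x t => sw_congr fun z u => ?_
  rw [sw_comm t u, sw_comm t u]
  exact (hr.sw_mul_comm u t (hf₂ (x * z))).symm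

/-- Both sides equal ∑ (b₁∘d₁)e₁ r(e₂⊗d₂b₂): the left by `sw_braidedMul`, the right by
`braidedMul_mul` once r(e₂⊗d₂b₂) is split. -/
theorem braidedMul_assoc (b d e : H) :
    braidedMul r (braidedMul r b d) e = braidedMul r b (braidedMul r d e) := by
  conv_lhs => rw [braidedMul, hr.sw_braidedMul (by fun_prop) (by fun_prop)]
  conv_rhs => rw [braidedMul.eq_1 (b := d), map_sw (φ := braidedMul r b) (by fun_prop)]
  have hb : IsLinearMap k (fun x => braidedMul r b x) := by fun_prop
  simp only [map_sw hb, hb.map_smul, hr.braidedMul_mul, hr.tmul_mul, const_smul_sw, sw_smul_const]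
  rw [sw_comm b d]
  refine sw_congr fun x y => ?_
  rw [sw_congr (k := k) (h := e) fun p q => sw_comm b p _]
  rw [sw_assoc (by fun_prop) (by fun_prop) (by fun_prop), sw_comm b e]
  refine sw_congr fun p q => ?_
  rw [sw_comm b q]
  simp only [smul_smul, _root_.mul_comm]

end IsUniversalRForm

end BraidedMul

/-! ### F and G for the opposite algebra are comodule algebra maps -/

section OpAlgebra

open Coalgebra HopfAlgebra MulOpposite

variable {k H : Type*} [Field k] [Ring H] [HopfAlgebra k H]

section Formulas

variable [FiniteDimensional k H] {r : H ⊗[k] H →ₗ[k] k}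

omit [FiniteDimensional k H] in
theorem AlgData.opposite_coact {A : Type*} [AddCommGroup A] [Module k A]
    (r : H ⊗[k] H →ₗ[k] k) (X : AlgData k H A) : (X.opposite r).coact = X.coact := rfl

theorem opAlgebra_coact (a : H) :
    (opAlgebra k H).coact (op a) = sw k a fun x y => op x ⊗ₜ[k] y := by
  simp [opAlgebra, ← sw_comul, coe_sw]

theorem opAlgebra_mul (a b : H) :
    (opAlgebra k H).mul (op a ⊗ₜ[k] op b) = op (b * a) := rfl

theorem braiding_opAlgebra (b c : H) :
    braiding r (opAlgebra k H).coact (opAlgebra k H).coact (op b ⊗ₜ[k] op c) =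
      sw k c fun z w => sw k b fun x y => r (w ⊗ₜ[k] y) • (op z ⊗ₜ[k] op x) := by
  rw [sw_comm]
  simp [braiding, opAlgebra_coact, coe_sw, sw_tmul_const, const_tmul_sw]

theorem opposite_opAlgebra_mul (b c : H) :
    ((opAlgebra k H).toAlgData.opposite r).mul (op b ⊗ₜ[k] op c) = op (braidedMul r b c) := by
  simp only [AlgData.opposite, LinearMap.comp_apply, braiding_opAlgebra, coe_sw, map_smul,
    opAlgebra_mul]
  rw [sw_comm]
  simp only [braidedMul, op_sw, op_smul]

theorem mapF_opAlgebra (a b c : H) :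
    (opAlgebra k H).mapF r (op a ⊗ₜ[k] op b) (op c) = op (braidedMul r b c * a) := by
  have := opposite_opAlgebra_mul (r := r) b c
  simp only [AlgData.opposite, LinearMap.comp_apply] at this
  simp [AlgData.mapF, this, opAlgebra_mul]

theorem mapG_opAlgebra (a b c : H) :
    (opAlgebra k H).mapG r (op a ⊗ₜ[k] op b) (op c) = op (b * braidedMul r c a) := by
  have := opposite_opAlgebra_mul (r := r) c a
  simp only [AlgData.opposite, LinearMap.comp_apply] at this
  simp [AlgData.mapG, this, opAlgebra_mul]

theorem tensorCoact_opAlgebra (a b : H) :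
    tensorCoact (opAlgebra k H).coact (opAlgebra k H).coact (op a ⊗ₜ[k] op b) =
      sw k a fun x y => sw k b fun z w => (op x ⊗ₜ[k] op z) ⊗ₜ[k] (w * y) := by
  rw [sw_comm]
  simp [tensorCoact, opAlgebra_coact, coe_sw, sw_tmul_const, const_tmul_sw]

theorem smash_opposite_mul (a b c d : H) :
    ((opAlgebra k H).toAlgData.smash r ((opAlgebra k H).toAlgData.opposite r)).mul
      ((op a ⊗ₜ[k] op b) ⊗ₜ[k] (op c ⊗ₜ[k] op d)) =
      sw k c fun z w => sw k b fun x y =>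
        r (w ⊗ₜ[k] y) • (op (z * a) ⊗ₜ[k] op (braidedMul r x d)) := by
  have := braiding_opAlgebra (r := r) b c
  simp [AlgData.smash, AlgData.opposite_coact, this, coe_sw, sw_tmul_const, const_tmul_sw,
    opposite_opAlgebra_mul, opAlgebra_mul, ← TensorProduct.smul_tmul']

theorem opposite_smash_mul (a b c d : H) :
    (((opAlgebra k H).toAlgData.opposite r).smash r (opAlgebra k H).toAlgData).mul
      ((op a ⊗ₜ[k] op b) ⊗ₜ[k] (op c ⊗ₜ[k] op d)) =
      sw k c fun z w => sw k b fun x y =>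
        r (w ⊗ₜ[k] y) • (op (braidedMul r a z) ⊗ₜ[k] op (d * x)) := by
  have := braiding_opAlgebra (r := r) b c
  simp [AlgData.smash, AlgData.opposite_coact, this, coe_sw, sw_tmul_const, const_tmul_sw,
    opposite_opAlgebra_mul, opAlgebra_mul, ← TensorProduct.smul_tmul']

omit [FiniteDimensional k H] in
theorem endCoact_eq_iff {M : Type*} [AddCommGroup M] [Module k M] [FiniteDimensional k M]
    (s : H ⊗[k] H →ₗ[k] H) (ρ : M →ₗ[k] M ⊗[k] H) (f : Module.End k M)
    (z : Module.End k M ⊗[k] H) :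
    endCoact s ρ f = z ↔ ∀ m, s.lTensor M (TensorProduct.assoc k M H H
      (ρ.rTensor H (f.rTensor H (ρ m)))) = rTensorHomEquivHomRTensor k M M H z m := by
  simp only [endCoact, LinearMap.comp_apply, LinearEquiv.coe_coe, LinearEquiv.symm_apply_eq]
  exact LinearMap.ext_iff

theorem endCoact_opAlgebra_eq {s : H ⊗[k] H →ₗ[k] H} {f : Module.End k Hᵐᵒᵖ}
    {z : Module.End k Hᵐᵒᵖ ⊗[k] H} {f' : H → H} (hf : ∀ c, f (op c) = op (f' c))
    (h : ∀ c, (sw k c fun x y => sw k (f' x) fun p q => op p ⊗ₜ[k] s (q ⊗ₜ[k] y)) =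
      rTensorHomEquivHomRTensor k Hᵐᵒᵖ Hᵐᵒᵖ H z (op c)) :
    endCoact s (opAlgebra k H).coact f = z := by
  rw [endCoact_eq_iff]
  intro m
  obtain ⟨c, rfl⟩ := op_surjective m
  rw [← h]
  simp [opAlgebra_coact, coe_sw, hf, sw_tmul_const]

end Formulas

variable [FiniteDimensional k H] {r : H ⊗[k] H →ₗ[k] k} (hr : IsUniversalRForm r)

include hr

namespace IsUniversalRForm

theorem mapF_map_one : (opAlgebra k H).mapF r (op 1 ⊗ₜ[k] op 1) = 1 := by
  ext c
  obtain ⟨c, rfl⟩ := op_surjective c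
  simp only [mapF_opAlgebra, hr.one_braidedMul, mul_one, Module.End.one_apply]

theorem mapG_map_one : (opAlgebra k H).mapG r (op 1 ⊗ₜ[k] op 1) = 1 := by
  ext c
  obtain ⟨c, rfl⟩ := op_surjective c
  simp only [mapG_opAlgebra, hr.braidedMul_one, one_mul, Module.End.one_apply]

theorem mapF_map_mul :
    (opAlgebra k H).mapF r ∘ₗ
      ((opAlgebra k H).toAlgData.smash r ((opAlgebra k H).toAlgData.opposite r)).mul =
    LinearMap.mul' k (Module.End k Hᵐᵒᵖ) ∘ₗ
      TensorProduct.map ((opAlgebra k H).mapF r) ((opAlgebra k H).mapF r) := by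
  refine TensorProduct.ext_fourfold' fun a b c d => LinearMap.ext fun e => ?_
  obtain ⟨a, rfl⟩ := op_surjective a
  obtain ⟨b, rfl⟩ := op_surjective b
  obtain ⟨c, rfl⟩ := op_surjective c
  obtain ⟨d, rfl⟩ := op_surjective d
  obtain ⟨e, rfl⟩ := op_surjective e
  simp only [LinearMap.comp_apply, smash_opposite_mul, coe_sw, map_smul, coe_sw_apply,
    LinearMap.smul_apply, mapF_opAlgebra, TensorProduct.map_tmul, LinearMap.mul'_apply,
    Module.End.mul_apply, hr.braidedMul_mul, hr.braidedMul_assoc, sw_mul_const, op_sw]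
  rw [sw_comm]
  simp [mul_assoc]

theorem mapG_map_mul :
    (opAlgebra k H).mapG r ∘ₗ
      (((opAlgebra k H).toAlgData.opposite r).smash r (opAlgebra k H).toAlgData).mul =
    (LinearMap.mul' k (Module.End k Hᵐᵒᵖ) ∘ₗ
      (TensorProduct.comm k (Module.End k Hᵐᵒᵖ) (Module.End k Hᵐᵒᵖ)).toLinearMap) ∘ₗ
      TensorProduct.map ((opAlgebra k H).mapG r) ((opAlgebra k H).mapG r) := by
  refine TensorProduct.ext_fourfold' fun a b c d => LinearMap.ext fun e => ?_
  obtain ⟨a, rfl⟩ := op_surjective a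
  obtain ⟨b, rfl⟩ := op_surjective b
  obtain ⟨c, rfl⟩ := op_surjective c
  obtain ⟨d, rfl⟩ := op_surjective d
  obtain ⟨e, rfl⟩ := op_surjective e
  simp only [LinearMap.comp_apply, opposite_smash_mul, coe_sw, map_smul, coe_sw_apply,
    LinearMap.smul_apply, mapG_opAlgebra, TensorProduct.map_tmul, LinearMap.mul'_apply,
    LinearEquiv.coe_coe, TensorProduct.comm_tmul,
    Module.End.mul_apply, hr.mul_braidedMul, hr.braidedMul_assoc, const_mul_sw, op_sw]
  rw [sw_comm]
  simp [mul_assoc]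

/-- The second leg of Δ((b∘c)a) is c₂b₂a₂, and the S⁻¹ in the coaction of End(A) removes c₂ from its
left. -/
theorem mapF_map_coact :
    (opAlgebra k H).endAlg.coact ∘ₗ (opAlgebra k H).mapF r =
      ((opAlgebra k H).mapF r).rTensor H ∘ₗ
        ((opAlgebra k H).toAlgData.smash r ((opAlgebra k H).toAlgData.opposite r)).coact := by
  refine TensorProduct.ext' fun a b => ?_
  obtain ⟨a, rfl⟩ := op_surjective a
  obtain ⟨b, rfl⟩ := op_surjective b
  refine endCoact_opAlgebra_eq (mapF_opAlgebra a b) fun c => ?_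
  have h₁ : (((opAlgebra k H).mapF r).rTensor H ∘ₗ
        ((opAlgebra k H).toAlgData.smash r ((opAlgebra k H).toAlgData.opposite r)).coact)
        (op a ⊗ₜ[k] op b) = ((opAlgebra k H).mapF r).rTensor H
          (sw k a fun x y => sw k b fun z w => (op x ⊗ₜ[k] op z) ⊗ₜ[k] (w * y)) :=
    congr(((opAlgebra k H).mapF r).rTensor H $(tensorCoact_opAlgebra a b))
  rw [h₁]
  simp only [coe_sw, coe_sw_apply, LinearMap.rTensor_tmul, rTensorHomEquivHomRTensor_apply,
    TensorProduct.rTensorHomToHomRTensor_apply, mapF_opAlgebra]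
  simp (disch := fun_prop) only [sw_mul, hr.sw_braidedMul]
  rw [sw_comm c b, sw_comm a b]
  refine sw_congr fun z w => ?_
  rw [sw_congr (k := k) (h := c) fun _ _ => sw_comm _ a _, sw_comm c a]
  refine sw_congr fun x y => ?_
  simpa [hr.antipodeInv_eq, mul_assoc] using hr.sw_skewAntipode_mul_cancel
    (g := fun p q => op (braidedMul r z p * x) ⊗ₜ[k] (q * (w * y))) (by fun_prop) (by fun_prop) c

/-- Here the second leg is b₂a₂c₂, and multiplying by S on the right removes c₂. -/
theorem mapG_map_coact :
    (opAlgebra k H).endOpAlg.coact ∘ₗ (opAlgebra k H).mapG r =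
      ((opAlgebra k H).mapG r).rTensor H ∘ₗ
        (((opAlgebra k H).toAlgData.opposite r).smash r (opAlgebra k H).toAlgData).coact := by
  refine TensorProduct.ext' fun a b => ?_
  obtain ⟨a, rfl⟩ := op_surjective a
  obtain ⟨b, rfl⟩ := op_surjective b
  refine endCoact_opAlgebra_eq (mapG_opAlgebra a b) fun c => ?_
  have h₁ : (((opAlgebra k H).mapG r).rTensor H ∘ₗ
        (((opAlgebra k H).toAlgData.opposite r).smash r (opAlgebra k H).toAlgData).coact)
        (op a ⊗ₜ[k] op b) = ((opAlgebra k H).mapG r).rTensor H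
          (sw k a fun x y => sw k b fun z w => (op x ⊗ₜ[k] op z) ⊗ₜ[k] (w * y)) :=
    congr(((opAlgebra k H).mapG r).rTensor H $(tensorCoact_opAlgebra a b))
  rw [h₁]
  simp only [coe_sw, coe_sw_apply, LinearMap.rTensor_tmul, rTensorHomEquivHomRTensor_apply,
    TensorProduct.rTensorHomToHomRTensor_apply, mapG_opAlgebra]
  simp (disch := fun_prop) only [sw_mul, hr.sw_braidedMul]
  rw [sw_comm c b, sw_comm a b]
  refine sw_congr fun z w => ?_
  rw [sw_congr (k := k) (h := c) fun _ _ => sw_comm _ a _, sw_comm c a]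
  refine sw_congr fun x y => ?_
  simpa [mul_assoc] using sw_mul_antipode_cancel_right (k := k)
    (g := fun p q => op (z * braidedMul r p x) ⊗ₜ[k] (w * (y * q))) (by fun_prop) (by fun_prop) c

end IsUniversalRForm

end OpAlgebra

/-! ### Injectivity of F and G versus nondegeneracy of r -/

section Bijectivity

open Coalgebra HopfAlgebra MulOpposite

variable {k H : Type*} [Field k] [Ring H] [HopfAlgebra k H]

theorem isLinearMap_tensor_ext {M N P : Type*} [AddCommGroup M] [Module k M] [AddCommGroup N]
    [Module k N] [AddCommGroup P] [Module k P] {f g : M ⊗[k] N → P} (hf : IsLinearMap k f)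
    (hg : IsLinearMap k g) (h : ∀ m n, f (m ⊗ₜ[k] n) = g (m ⊗ₜ[k] n)) (w : M ⊗[k] N) :
    f w = g w :=
  congr($(TensorProduct.ext' (g := hf.mk') (h := hg.mk') h) w)

@[fun_prop]
theorem isLinearMap_unop {M N : Type*} [AddCommGroup M] [Module k M] [AddCommGroup N] [Module k N]
    {f : M → Nᵐᵒᵖ} (hf : IsLinearMap k f) : IsLinearMap k (fun x => unop (f x)) :=
  ⟨fun x y => by rw [hf.map_add, unop_add], fun c x => by rw [hf.map_smul, unop_smul]⟩

/-- The linear map on `M ⊗ N` with `m ⊗ n ↦ f(m, n)`, for a bilinear function `f`. -/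
def liftTmul {M N P : Type*} [AddCommGroup M] [Module k M] [AddCommGroup N]
    [Module k N] [AddCommGroup P] [Module k P] (f : M → N → P)
    (hf₁ : ∀ n, IsLinearMap k (fun m => f m n)) (hf₂ : ∀ m, IsLinearMap k (fun n => f m n)) :
    M ⊗[k] N →ₗ[k] P :=
  TensorProduct.lift (LinearMap.mk₂ k f (fun x x' y => (hf₁ y).map_add x x')
    (fun c x y => (hf₁ y).map_smul c x) (fun x y y' => (hf₂ x).map_add y y')
    (fun c x y => (hf₂ x).map_smul c y))

theorem liftTmul_tmul {M N P : Type*} [AddCommGroup M] [Module k M] [AddCommGroup N]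
    [Module k N] [AddCommGroup P] [Module k P] (f : M → N → P)
    (hf₁ : ∀ n, IsLinearMap k (fun m => f m n)) (hf₂ : ∀ m, IsLinearMap k (fun n => f m n))
    (m : M) (n : N) : liftTmul f hf₁ hf₂ (m ⊗ₜ[k] n) = f m n := rfl

theorem dualTensorHom_rTensor_injective [FiniteDimensional k H] {ρ : H →ₗ[k] Module.Dual k H}
    (hρ : Function.Injective ρ) :
    Function.Injective (dualTensorHom k H H ∘ₗ ρ.rTensor H) := by
  have h₁ : Function.Injective (dualTensorHom k H H) := by
    exact (dualTensorHomEquiv k H H).injective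
  exact h₁.comp (Module.Flat.rTensor_preserves_injective_linearMap ρ hρ)

theorem curry_injective_of_theta_surjective {r : H ⊗[k] H →ₗ[k] k}
    (h : Function.Surjective (theta r)) : Function.Injective (TensorProduct.curry r) := by
  rw [injective_iff_map_eq_zero]
  intro a ha
  rw [← Module.forall_dual_apply_eq_zero_iff k]
  intro φ
  obtain ⟨b, rfl⟩ := h φ
  exact congr($ha b.unop)

namespace IsUniversalRForm

variable [FiniteDimensional k H] {r : H ⊗[k] H →ₗ[k] k} (hr : IsUniversalRForm r)

include hr

theorem mapF_injective (h : Function.Injective (theta r)) :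
    Function.Injective ((opAlgebra k H).mapF r) := by
  let ρ : H →ₗ[k] Module.Dual k H := theta r ∘ₗ (opLinearEquiv k).toLinearMap
  have hρ : Function.Injective ρ := h.comp (opLinearEquiv k).injective
  let κ : Hᵐᵒᵖ ⊗[k] Hᵐᵒᵖ →ₗ[k] H ⊗[k] H :=
    liftTmul (fun a b => sw k b.unop fun x y => x ⊗ₜ[k] (y * a.unop)) (by fun_prop) (by fun_prop)
  -- The inverse shear: S(b₂)b₃a collapses to a.
  let κ' : H ⊗[k] H →ₗ[k] Hᵐᵒᵖ ⊗[k] Hᵐᵒᵖ :=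
    liftTmul (fun x y => sw k x fun p q => op (antipode k q * y) ⊗ₜ[k] op p) (by fun_prop)
      (by fun_prop)
  have hκ : Function.LeftInverse κ' κ := by
    refine isLinearMap_tensor_ext ?_ ?_ fun a b => ?_
    · fun_prop
    · fun_prop
    simp only [κ, κ', liftTmul_tmul, coe_sw]
    rw [sw_assoc (by fun_prop) (by fun_prop) (by fun_prop)]
    obtain ⟨a, rfl⟩ := op_surjective a
    obtain ⟨b, rfl⟩ := op_surjective b
    simp only [← mul_assoc, ← sw_mul_const, ← op_sw, ← sw_tmul_const, sw_antipode_mul, unop_op]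
    simpa [TensorProduct.smul_tmul'] using
      sw_smul_counit (k := k) (g := fun x => op a ⊗ₜ[k] op x) (by fun_prop) b
  -- Convolution with S⁻¹ factors F(w) through the shear κ followed by θ_r on the first leg.
  have key (c : H) (w : Hᵐᵒᵖ ⊗[k] Hᵐᵒᵖ) :
      (sw k c fun p q => skewAntipode r q * unop ((opAlgebra k H).mapF r w (op p))) =
        dualTensorHom k H H (ρ.rTensor H (κ w)) c := by
    revert w
    refine isLinearMap_tensor_ext ?_ ?_ fun a b => ?_
    · fun_prop
    · exact isLinearMap_coe_apply
        (isLinearMap_coe (dualTensorHom k H H ∘ₗ ρ.rTensor H ∘ₗ κ)) c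
    obtain ⟨a, rfl⟩ := op_surjective a
    obtain ⟨b, rfl⟩ := op_surjective b
    simp only [mapF_opAlgebra, hr.braidedMul_eq, κ, liftTmul_tmul, coe_sw, coe_sw_apply, unop_op,
      sw_mul_const, const_mul_sw, LinearMap.rTensor_tmul, dualTensorHom_apply]
    rw [sw_comm]
    refine sw_congr fun x y => ?_
    rw [show ρ x c = r (c ⊗ₜ[k] x) from rfl]
    simpa [mul_assoc] using hr.sw_skewAntipode_mul_cancel
      (g := fun z u => r (z ⊗ₜ[k] x) • (u * (y * a))) (by fun_prop) (by fun_prop) c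
  rw [injective_iff_map_eq_zero]
  intro w hw
  refine hκ.injective (dualTensorHom_rTensor_injective hρ ?_)
  refine LinearMap.ext fun c => ?_
  simp [← key, hw, sw]

theorem mapG_injective (h : Function.Injective (TensorProduct.curry r)) :
    Function.Injective ((opAlgebra k H).mapG r) := by
  let κ : Hᵐᵒᵖ ⊗[k] Hᵐᵒᵖ →ₗ[k] H ⊗[k] H :=
    liftTmul (fun a b => sw k a.unop fun x y => x ⊗ₜ[k] (b.unop * y)) (by fun_prop) (by fun_prop)
  -- Undoing right multiplication by a₂ needs S⁻¹ rather than S, since a₃S⁻¹(a₂) is what cancels.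
  let κ' : H ⊗[k] H →ₗ[k] Hᵐᵒᵖ ⊗[k] Hᵐᵒᵖ :=
    liftTmul (fun x y => sw k x fun p q => op p ⊗ₜ[k] op (y * skewAntipode r q)) (by fun_prop)
      (by fun_prop)
  have hκ : Function.LeftInverse κ' κ := by
    refine isLinearMap_tensor_ext ?_ ?_ fun a b => ?_
    · fun_prop
    · fun_prop
    simp only [κ, κ', liftTmul_tmul, coe_sw]
    rw [sw_assoc (by fun_prop) (by fun_prop) (by fun_prop)]
    obtain ⟨a, rfl⟩ := op_surjective a
    obtain ⟨b, rfl⟩ := op_surjective b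
    simpa [mul_assoc] using hr.sw_mul_skewAntipode_cancel
      (g := fun x y => op x ⊗ₜ[k] op (b * y)) (by fun_prop) (by fun_prop) a
  have key (c : H) (w : Hᵐᵒᵖ ⊗[k] Hᵐᵒᵖ) :
      (sw k c fun p q => unop ((opAlgebra k H).mapG r w (op p)) * antipode k q) =
        dualTensorHom k H H ((TensorProduct.curry r).rTensor H (κ w)) c := by
    revert w
    refine isLinearMap_tensor_ext ?_ ?_ fun a b => ?_
    · fun_prop
    · exact isLinearMap_coe_apply
        (isLinearMap_coe (dualTensorHom k H H ∘ₗ (TensorProduct.curry r).rTensor H ∘ₗ κ)) c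
    obtain ⟨a, rfl⟩ := op_surjective a
    obtain ⟨b, rfl⟩ := op_surjective b
    simp only [mapG_opAlgebra, hr.braidedMul_eq, κ, liftTmul_tmul, coe_sw, coe_sw_apply, unop_op,
      sw_mul_const, const_mul_sw, LinearMap.rTensor_tmul, dualTensorHom_apply]
    rw [sw_congr (k := k) (h := c) fun _ _ => sw_comm _ a _, sw_comm]
    refine sw_congr fun x y => ?_
    simpa [mul_assoc] using sw_mul_antipode_cancel_right (k := k)
      (g := fun z u => r (x ⊗ₜ[k] z) • (b * (y * u))) (by fun_prop) (by fun_prop) c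
  rw [injective_iff_map_eq_zero]
  intro w hw
  refine hκ.injective (dualTensorHom_rTensor_injective h ?_)
  refine LinearMap.ext fun c => ?_
  simp [← key, hw, sw]

theorem theta_injective_of_mapF (h : Function.Injective ((opAlgebra k H).mapF r)) :
    Function.Injective (theta r) := by
  rw [injective_iff_map_eq_zero]
  intro b hb
  obtain ⟨b, rfl⟩ := op_surjective b
  have hb' (c : H) : r (c ⊗ₜ[k] b) = 0 := congr($hb c)
  -- With a = S(b₂) the trailing b₂a in F cancels, leaving ∑ r(c₁⊗b) c₂ = 0.
  have hw : (sw k b fun x y => op (antipode k y) ⊗ₜ[k] op x) = 0 := by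
    refine h (LinearMap.ext fun c => ?_)
    obtain ⟨c, rfl⟩ := op_surjective c
    simp only [coe_sw, coe_sw_apply, mapF_opAlgebra, hr.braidedMul_eq, sw_mul_const, ← op_sw]
    rw [sw_assoc (by fun_prop) (by fun_prop) (by fun_prop)]
    have h₁ (x t : H) : (sw k t fun y z => sw k c fun p q =>
        r (p ⊗ₜ[k] x) • (q * y) * antipode k z) =
        counit (R := k) t • sw k c fun p q => r (p ⊗ₜ[k] x) • q := by
      rw [sw_comm, const_smul_sw]
      refine sw_congr fun p q => ?_
      simp only [smul_mul_assoc, mul_assoc, ← const_smul_sw, ← const_mul_sw, sw_mul_antipode]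
      simp [smul_comm (counit (R := k) t)]
    simp only [h₁]
    rw [sw_smul_counit (k := k) (g := fun x => sw k c fun p q => r (p ⊗ₜ[k] x) • q) (by fun_prop)]
    simp [hb', sw]
  -- Since ε ∘ S = ε, applying ε to the first factor turns this vanishing tensor into b.
  have := congr(liftTmul (k := k) (fun x y : Hᵐᵒᵖ => counit (R := k) x.unop • y.unop)
    (by fun_prop) (by fun_prop) $hw)
  simp only [coe_sw, liftTmul_tmul, unop_op, counit_antipode, map_zero] at this
  rw [sw_smul_counit (k := k) (g := fun x => x) (by fun_prop)] at this
  rw [this, op_zero]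

theorem isAzumaya_opAlgebra (h : Function.Bijective (theta r)) :
    (opAlgebra k H).IsAzumaya r := by
  have := (opAlgebra k H).finite
  have hfin : Module.finrank k (Hᵐᵒᵖ ⊗[k] Hᵐᵒᵖ) = Module.finrank k (Module.End k Hᵐᵒᵖ) := by
    simp [Module.finrank_linearMap]
  have hF := hr.mapF_injective h.1
  have hG := hr.mapG_injective (curry_injective_of_theta_surjective h.2)
  exact ⟨⟨⟨hF, (LinearMap.injective_iff_surjective_of_finrank_eq_finrank hfin).1 hF⟩,
      hr.mapF_map_mul, hr.mapF_map_one, hr.mapF_map_coact⟩,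
    ⟨⟨hG, (LinearMap.injective_iff_surjective_of_finrank_eq_finrank hfin).1 hG⟩,
      hr.mapG_map_mul, hr.mapG_map_one, hr.mapG_map_coact⟩⟩

end IsUniversalRForm

end Bijectivity

end DualQuasitriangular

end

open scoped TensorProduct in
/-- For a finite-dimensional dual quasitriangular Hopf algebra `(H, r)` over a field, the comodule
algebra `H^op` is `(H, r)`-Azumaya if and only if `θ_r : h ↦ r(- ⊗ h)` is bijective. -/
theorem corollary2p2 {k : Type*} {H : Type*} [Field k] [Ring H] [HopfAlgebra k H]
    [FiniteDimensional k H] (r : H ⊗[k] H →ₗ[k] k)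
    (hr : DualQuasitriangular.IsUniversalRForm r) :
    (DualQuasitriangular.opAlgebra k H).IsAzumaya r ↔
      Function.Bijective (DualQuasitriangular.theta r) := by
  refine ⟨fun h => ?_, hr.isAzumaya_opAlgebra⟩
  -- Injectivity of F alone suffices for this direction.
  have hθ := hr.theta_injective_of_mapF h.1.bijective.1
  have hfin : Module.finrank k Hᵐᵒᵖ = Module.finrank k (Module.Dual k H) := by
    rw [Subspace.dual_finrank_eq]
    exact (MulOpposite.opLinearEquiv k : H ≃ₗ[k] Hᵐᵒᵖ).symm.finrank_eq
  have : FiniteDimensional k Hᵐᵒᵖ := (DualQuasitriangular.opAlgebra k H).finite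
  exact ⟨hθ, (LinearMap.injective_iff_surjective_of_finrank_eq_finrank hfin).1 hθ⟩
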